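/- Let $\mathcal X$ (observations) and $\tilde{\mathcal X}$ (corrupted observations) be measurable spaces, for instance subsets of $\mathbb R^a$, let the latent space be $\mathbb R^b$, and let $dx$ and $dz$ be $\sigma$-finite reference measures on $\mathcal X$ and $\mathbb R^b$ (for instance Lebesgue measure). Let $P(X)$ be a probability distribution on $\mathcal X$ (the data distribution), and let the decoder be a Markov kernel $P_\theta(X|Z)$ from $\mathbb R^b$ to $\mathcal X$ with a jointly measurable conditional density $P_\theta(x|z)$ with respect to $dx$. **(A) Generative autoencoders.** Let the encoder be a Markov kernel $Q_\phi(Z|X)$ from $\mathcal X$ to $\mathbb R^b$ such that for every $dz$-null set $N$ one has $Q_\phi(N|x)=0$ for $dx$-almost every $x$ (e.g. $Q_\phi(\cdot|x)$ has a density with respect to $dz$). Consider the latent Markov chain with transition operator $$T(Z_{t+1}|Z_t)=\int Q_\phi(Z_{t+1}|X)\,P_\theta(X|Z_t)\,dX ,$$ and the learned latent distribution $\hat P(Z)=\int Q_\phi(Z|X)P(X)\,dX$. Call the chain *ergodic* if it is irreducible (from every state, every set of positive $dz$-measure is reached with positive probability in finitely many steps) and aperiodic (there are no $d\ge 2$ pairwise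 disjoint measurable sets of positive $dz$-measure which the chain visits cyclically with probability one). Call $P_\theta(X|Z)$ *positive* if for every $z$, $P_\theta(x|z)>0$ for $dx$-almost every $x$, and $Q_\phi(Z|X)$ *positive* if every set $B\subseteq\mathbb R^b$ of positive $dz$-measure satisfies $Q_\phi(B|x)>0$ for a set of $x$ of positive $dx$-measure (e.g. $Q_\phi(\cdot|x)$ has a positive density for every $x$). Then: 1. If $P_\theta(X|Z)$ and $Q_\phi(Z|X)$ are positive, then the chain is ergodic. Suppose in addition that the decoder maps $\hat P(Z)$ to the data distribution, that is, $\int P_\theta(X|Z)\hat P(Z)\,dZ=P(X)$. Then: 2. $\hat P(Z)$ is a stationary distribution of the chain. 3. If the chain is ergodic, then it has exactly one stationary distribution $\Pi(Z)$, namely $\Pi(Z)=\hat P(Z)$, and from every initial distribution on $\mathbb R^b$ the law of $Z_t$ converges to $\Pi(Z)$ in total variation as $t\to\infty$. 4. Hence, if $P_\theta(X|Z)$ and $Q_\phi(Z|X)$ are positive, then the conclusion of 3 holds. **(B) Denoising generative autoencoders.** Let moreover $C(\tilde X|X)$ be a Markov kernel from $\mathcal X$ to $\tilde{\mathcal X}$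 (the corruption process), let the encoder $Q_\phi(Z|\tilde X)$ be a Markov kernel from $\tilde{\mathcal X}$ to $\mathbb R^b$, and put $$T(Z_{t+1}|Z_t)=\iint Q_\phi(Z_{t+1}|\tilde X)\,C(\tilde X|X)\,P_\theta(X|Z_t)\,dX\,d\tilde X ,\qquad \hat P(Z)=\iint Q_\phi(Z|\tilde X)\,C(\tilde X|X)\,P(X)\,dX\,d\tilde X .$$ With this $T$ and this $\hat P$, the same statements 1–4 hold, where in the two conditions on the encoder the measure $dx$ is replaced by its image $\int C(\cdot|x)\,dx$ on $\tilde{\mathcal X}$. -/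

import Mathlib

open MeasureTheory ProbabilityTheory Filter Topology
open scoped ENNReal

noncomputable section

namespace GenAE

/-- The latent space `ℝ^b`. -/
abbrev Latent (b : ℕ) : Type := EuclideanSpace ℝ (Fin b)

section Chains

variable {α : Type*} [MeasurableSpace α]

/-- Total variation distance `sup_A |μ(A) - ν(A)|` over measurable sets `A`
(used for probability measures only, where the supremum is over a set bounded by `1`). -/
def tvDist (μ ν : Measure α) : ℝ :=
  ⨆ A : {A : Set α // MeasurableSet A}, |μ.real A - ν.real A|

/-- Aperiodicity of a Markov kernel, relative to a reference measure `φ`: there is no cyclic family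
of `d ≥ 2` pairwise disjoint measurable sets of states, of positive `φ`-measure,
such that the chain moves from each set to the next one with probability one. -/
def IsAperiodic (φ : Measure α) (T : Kernel α α) : Prop :=
  ¬ ∃ d : ℕ, 2 ≤ d ∧ ∃ D : ZMod d → Set α,
    (∀ i, MeasurableSet (D i)) ∧ Pairwise (fun i j => Disjoint (D i) (D j)) ∧
    (∀ i, 0 < φ (D i)) ∧ ∀ i, ∀ x ∈ D i, T x (D (i + 1)) = 1

/-- A Markov chain is ergodic if it is irreducible (every set of states of positive reference
measure is reached from every state, with positive probability, in finitely many steps) and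
aperiodic. -/
structure IsErgodicChain (φ : Measure α) (T : Kernel α α) : Prop where
  irreducible : Kernel.IsIrreducible φ T
  aperiodic : IsAperiodic φ T

/-- The law of the state at time `t` of the chain with transition kernel `T` and
initial distribution `μ`. -/
def chainLaw (T : Kernel α α) (μ : Measure α) (t : ℕ) : Measure α :=
  (T ^ t : Kernel α α) ∘ₘ μ

/-- `π` is the stationary distribution of the chain (it is stationary, and no other probability
measure is), and from every initial distribution the law of the chain converges to `π` in total
variation. -/
structure ConvergesToStationary (T : Kernel α α) (π : Measure α) : Prop where
  stationary : T.Invariant π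
  unique : ∀ π' : Measure α, IsProbabilityMeasure π' → T.Invariant π' → π' = π
  tendsto : ∀ μ : Measure α, IsProbabilityMeasure μ →
    Tendsto (fun t => tvDist (chainLaw T μ t) π) atTop (𝓝 0)

end Chains

section Autoencoder

variable {b : ℕ} {𝒳 𝒴 : Type*} [MeasurableSpace 𝒳] [MeasurableSpace 𝒴]

/-- The transition operator "decode, then encode":
`T(dz' | z) = ∫ Q(dz' | x) P(dx | z)`. -/
def transition (Q : Kernel 𝒳 (Latent b)) (P : Kernel (Latent b) 𝒳) :
    Kernel (Latent b) (Latent b) :=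
  Q ∘ₖ P

/-- The transition operator "decode, then corrupt, then encode":
`T(dz' | z) = ∫∫ Q(dz' | y) C(dy | x) P(dx | z)`. -/
def denoisingTransition (Q : Kernel 𝒴 (Latent b)) (C : Kernel 𝒳 𝒴) (P : Kernel (Latent b) 𝒳) :
    Kernel (Latent b) (Latent b) :=
  Q ∘ₖ (C ∘ₖ P)

/-- The learned latent distribution `∫ Q(dz | x) P(dx)`, with `data` the distribution of `x`. -/
def learnedLatent (Q : Kernel 𝒳 (Latent b)) (data : Measure 𝒳) : Measure (Latent b) :=
  Q ∘ₘ data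

/-- The learned latent distribution of a denoising autoencoder, whose encoder is fed with
corrupted data: `∫∫ Q(dz | y) C(dy | x) P(dx)`. -/
def denoisingLearnedLatent (Q : Kernel 𝒴 (Latent b)) (C : Kernel 𝒳 𝒴) (data : Measure 𝒳) :
    Measure (Latent b) :=
  Q ∘ₘ (C ∘ₘ data)

/-- The decoder maps latent samples with distribution `latent` to samples with the data
distribution: `∫ P(dx | z) latent(dz) = data(dx)`. -/
def DecodesTo (P : Kernel (Latent b) 𝒳) (latent : Measure (Latent b)) (data : Measure 𝒳) : Prop :=
  P ∘ₘ latent = data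

/-- `p` is a (jointly measurable) conditional density `P(x | z)` of the decoder with respect to
the reference measure `dx = refX`. -/
def IsDecoderDensity (refX : Measure 𝒳) (P : Kernel (Latent b) 𝒳) (p : Latent b → 𝒳 → ℝ≥0∞) :
    Prop :=
  Measurable (Function.uncurry p) ∧ ∀ z, P z = refX.withDensity (p z)

/-- `P(x | z) > 0`: from every latent `z`, almost every observation can be generated. -/
def DecoderPositive (refX : Measure 𝒳) (p : Latent b → 𝒳 → ℝ≥0∞) : Prop :=
  ∀ z, ∀ᵐ x ∂refX, 0 < p z x

/-- A set of latent codes that is negligible for `dz = refZ` is produced by the encoder with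
probability zero from almost every input. This holds in particular if every `Q(· | x)` has a
density with respect to `refZ`; it also allows deterministic encoders `x ↦ δ_{e(x)}` such that
`e` maps `refIn` to a measure that is absolutely continuous with respect to `refZ`. -/
def EncoderNonsingular (refIn : Measure 𝒳) (refZ : Measure (Latent b))
    (Q : Kernel 𝒳 (Latent b)) : Prop :=
  ∀ N : Set (Latent b), MeasurableSet N → refZ N = 0 → ∀ᵐ x ∂refIn, Q x N = 0

/-- `Q(z | x) > 0`, in the sense that all latent codes can be generated: every non-negligible set of
latent codes has positive probability under the encoder for a non-negligible set of inputs. If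
`refIn ≠ 0`, this holds in particular if every `Q(· | x)` has a positive density with respect
to `refZ`. -/
def EncoderPositive (refIn : Measure 𝒳) (refZ : Measure (Latent b))
    (Q : Kernel 𝒳 (Latent b)) : Prop :=
  ∀ B : Set (Latent b), MeasurableSet B → 0 < refZ B → 0 < refIn {x | 0 < Q x B}

end Autoencoder

end GenAE

end

/-! The denoising chain is the plain one with encoder `Q ∘ₖ C`, and stationarity is associativity of
kernel composition. Positivity lets one step reach every set of positive reference measure, which
gives ergodicity. The core is `tendsto_tvDist_chainLaw`: total variation convergence of an ergodic
chain whose transition laws are absolutely continuous.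

Irreducibility gives φ ≪ π, so `T x ≪ π` for every x. If convergence failed, there would be times n
→ ∞ and sets A with μTⁿ(A) − π(A) bounded below by a positive constant. The functions Tⁿ⁻ᵏ1_A
subconverge pointwise to a space-time harmonic h indexed by all k ∈ ℤ
(`exists_subseq_tendsto_isSpaceTimeHarmonic`), and the gap survives as ∫h₀dμ > ∫h₀dπ.

This is absurd because h is constant (`IsSpaceTimeHarmonic.eq_of_isErgodicChain`). By Jensen the
energy ∫hₖ²dπ increases with k. A limit g of forward time shifts of h has constant energy, so
gₖ₊₁(y) = gₖ(x) for almost every transition x → y: the sequence (gₖ(x))ₖ evolves deterministically,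
by a shift. Ergodicity makes it constant (`exists_ae_eq_const_of_forall_ae_eq`). Hence the supremal
energy of h is the square of its mean, and h has no variance. -/

namespace GenAE

/-! ### Compactness of space-time harmonic functions -/

section Kernels

variable {α : Type*} [MeasurableSpace α]

instance isMarkovKernel_pow (T : Kernel α α) [IsMarkovKernel T] (n : ℕ) :
    IsMarkovKernel (T ^ n) := by
  induction n with
  | zero => rw [pow_zero]; exact inferInstanceAs (IsMarkovKernel Kernel.id)
  | succ n ih =>
    rw [pow_succ]
    exact inferInstanceAs (IsMarkovKernel ((T ^ n) ∘ₖ T))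

lemma integrable_of_mem_Icc {μ : Measure α} [IsFiniteMeasure μ] {f : α → ℝ}
    (hf : Measurable f) (h : ∀ x, f x ∈ Set.Icc (0 : ℝ) 1) : Integrable f μ :=
  Integrable.of_mem_Icc 0 1 hf.aemeasurable (ae_of_all _ h)

lemma integral_mem_Icc {μ : Measure α} [IsProbabilityMeasure μ] {f : α → ℝ}
    (hf : Measurable f) (h : ∀ x, f x ∈ Set.Icc (0 : ℝ) 1) : ∫ x, f x ∂μ ∈ Set.Icc (0 : ℝ) 1 := by
  refine ⟨integral_nonneg fun x => (h x).1, ?_⟩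
  calc ∫ x, f x ∂μ ≤ ∫ _, (1 : ℝ) ∂μ :=
        integral_mono (integrable_of_mem_Icc hf h) (integrable_const _) fun x => (h x).2
    _ = 1 := by simp

lemma measurable_integral_kernel (T : Kernel α α) {f : α → ℝ} (hf : Measurable f) :
    Measurable fun x => ∫ y, f y ∂T x :=
  (hf.stronglyMeasurable.integral_kernel (κ := T)).measurable

lemma integral_comp_measure (T : Kernel α α) (μ : Measure α) {f : α → ℝ}
    (hf : Integrable f (T ∘ₘ μ)) : ∫ x, f x ∂(T ∘ₘ μ) = ∫ x, ∫ y, f y ∂T x ∂μ := by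
  rw [Measure.comp_eq_comp_const_apply] at hf ⊢
  rw [Kernel.integral_comp hf, Kernel.const_apply]

lemma integral_pow_succ (T : Kernel α α) [IsMarkovKernel T] (n : ℕ) (x : α) {f : α → ℝ}
    (hf : Measurable f) (h : ∀ x, f x ∈ Set.Icc (0 : ℝ) 1) :
    ∫ y, f y ∂(T ^ (n + 1)) x = ∫ y, ∫ z, f z ∂(T ^ n) y ∂T x := by
  have hpow : T ^ (n + 1) = (T ^ n) ∘ₖ T := pow_succ T n
  rw [hpow]
  exact Kernel.integral_comp (integrable_of_mem_Icc hf h)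

/-- A bounded family of functions indexed by time whose values along the chain form a
martingale. -/
structure IsSpaceTimeHarmonic (T : Kernel α α) (h : ℤ → α → ℝ) : Prop where
  measurable : ∀ k, Measurable (h k)
  mem_Icc : ∀ k x, h k x ∈ Set.Icc (0 : ℝ) 1
  eq_integral : ∀ k x, h k x = ∫ y, h (k + 1) y ∂T x

/-- The density of `T x` with respect to `π`, as an element of `L¹(π)`. -/
noncomputable def densityL1 (T : Kernel α α) [IsFiniteKernel T] (π : Measure α) (x : α) :
    Lp ℝ 1 π :=
  (Measure.integrable_toReal_rnDeriv (μ := T x) (ν := π)).toL1 _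

/-- The bound is uniform in f: all functions x ↦ ∫ f dT x are 1-Lipschitz for the pseudometric
pulled back from L¹(π). This is the equicontinuity behind the compactness below. -/
lemma abs_integral_sub_le_norm_densityL1_sub {T : Kernel α α} [IsMarkovKernel T] {π : Measure α}
    [IsProbabilityMeasure π] (hac : ∀ x, T x ≪ π) {f : α → ℝ}
    (hf : Measurable f) (h : ∀ x, f x ∈ Set.Icc (0 : ℝ) 1) (x y : α) :
    |∫ z, f z ∂T x - ∫ z, f z ∂T y| ≤ ‖densityL1 T π x - densityL1 T π y‖ := by
  have hint : ∀ x, Integrable (fun z => ((T x).rnDeriv π z).toReal * f z) π := fun x =>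
    (Measure.integrable_toReal_rnDeriv (μ := T x) (ν := π)).mul_bdd (c := 1) hf.aestronglyMeasurable
      (ae_of_all _ fun z => by
        rw [Real.norm_eq_abs, abs_of_nonneg (h z).1]; exact (h z).2)
  rw [← integral_rnDeriv_smul (hac x) (f := f), ← integral_rnDeriv_smul (hac y) (f := f)]
  simp only [smul_eq_mul]
  rw [← integral_sub (hint x) (hint y), L1.norm_eq_integral_norm, ← Real.norm_eq_abs]
  refine (norm_integral_le_integral_norm _).trans ?_
  refine integral_mono_ae ((hint x).sub (hint y)).norm (L1.integrable_coeFn _).norm ?_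
  filter_upwards [Lp.coeFn_sub (densityL1 T π x) (densityL1 T π y),
    (Measure.integrable_toReal_rnDeriv (μ := T x) (ν := π)).coeFn_toL1,
    (Measure.integrable_toReal_rnDeriv (μ := T y) (ν := π)).coeFn_toL1] with z h1 h2 h3
  rw [h1, Pi.sub_apply, densityL1, densityL1, h2, h3, ← sub_mul, norm_mul]
  refine mul_le_of_le_one_right (norm_nonneg _) ?_
  rw [Real.norm_eq_abs, abs_of_nonneg (h z).1]; exact (h z).2

/-- An Arzelà–Ascoli argument. L¹(π) is separable since the σ-algebra is countably generated, so a
subsequence converging at countably many points with dense densities converges at every point by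
equicontinuity. Dominated convergence passes harmonicity to the limit. -/
lemma exists_subseq_tendsto_isSpaceTimeHarmonic [MeasurableSpace.CountablyGenerated α]
    {T : Kernel α α} [IsMarkovKernel T] {π : Measure α}
    [IsProbabilityMeasure π] (hac : ∀ x, T x ≪ π) {u : ℕ → ℤ → α → ℝ}
    (hu : ∀ n k, Measurable (u n k)) (hu01 : ∀ n k x, u n k x ∈ Set.Icc (0 : ℝ) 1)
    (hharm : ∀ k, ∀ᶠ n in atTop, ∀ x, u n k x = ∫ y, u n (k + 1) y ∂T x) :
    ∃ φ : ℕ → ℕ, StrictMono φ ∧ ∃ h, IsSpaceTimeHarmonic T h ∧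
      ∀ k x, Tendsto (fun n => u (φ n) k x) atTop (𝓝 (h k x)) := by
  have : Nonempty α := nonempty_of_isProbabilityMeasure π
  have : Fact ((1 : ℝ≥0∞) ≠ ∞) := ⟨ENNReal.one_ne_top⟩
  let R := Set.range (densityL1 T π)
  have hne : Nonempty R := (Set.range_nonempty _).to_subtype
  have hq : ∀ i, ∃ x, densityL1 T π x = TopologicalSpace.denseSeq R i := fun i =>
    (TopologicalSpace.denseSeq R i).2
  choose q hq using hq
  have hdense : ∀ x, ∀ ε > 0, ∃ i, ‖densityL1 T π x - densityL1 T π (q i)‖ < ε := by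
    intro x ε hε
    obtain ⟨i, hi⟩ := Metric.denseRange_iff.1 (TopologicalSpace.denseRange_denseSeq R)
      ⟨densityL1 T π x, x, rfl⟩ ε hε
    refine ⟨i, ?_⟩
    rw [hq, ← dist_eq_norm]
    exact hi
  -- Sequential compactness of a countable product of intervals replaces the diagonal extraction.
  let v : ℕ → ℕ → ℤ → Set.Icc (0 : ℝ) 1 := fun n i k => ⟨u n k (q i), hu01 n k (q i)⟩
  obtain ⟨a, φ, hφ, ha⟩ := CompactSpace.tendsto_subseq v
  have hconv : ∀ i k, Tendsto (fun n => u (φ n) k (q i)) atTop (𝓝 (a i k : ℝ)) := by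
    intro i k
    have h1 := tendsto_pi_nhds.1 (tendsto_pi_nhds.1 ha i) k
    exact (continuous_subtype_val.tendsto _).comp h1
  have hharm' : ∀ k, ∀ᶠ n in atTop, ∀ x, u (φ n) k x = ∫ y, u (φ n) (k + 1) y ∂T x :=
    fun k => hφ.tendsto_atTop.eventually (hharm k)
  have hcauchy : ∀ k x, ∃ l, Tendsto (fun n => u (φ n) k x) atTop (𝓝 l) := by
    intro k x
    refine cauchySeq_tendsto_of_complete (Metric.cauchySeq_iff'.2 fun ε hε => ?_)
    obtain ⟨i, hi⟩ := hdense x (ε / 3) (by positivity)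
    obtain ⟨N, hN⟩ := eventually_atTop.1 (hharm' k)
    obtain ⟨M, hM⟩ := Metric.cauchySeq_iff.1 (hconv i k).cauchySeq (ε / 3) (by positivity)
    have hclose : ∀ n ≥ N, |u (φ n) k x - u (φ n) k (q i)| < ε / 3 := by
      intro n hn
      rw [hN n hn x, hN n hn (q i)]
      exact (abs_integral_sub_le_norm_densityL1_sub hac (hu _ _) (hu01 _ _) _ _).trans_lt hi
    refine ⟨max N M, fun n hn => ?_⟩
    have h1 := hclose n (le_of_max_le_left hn)
    have h2 := hclose (max N M) (le_max_left _ _)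
    have h3 := hM n (le_of_max_le_right hn) (max N M) (le_max_right _ _)
    rw [Real.dist_eq] at h3 ⊢
    rw [abs_lt] at *
    constructor <;> linarith [h1.1, h1.2, h2.1, h2.2, h3.1, h3.2]
  choose h hh using hcauchy
  have hmeas : ∀ k, Measurable (h k) := fun k =>
    measurable_of_tendsto_metrizable (fun n => hu (φ n) k) (tendsto_pi_nhds.2 (hh k))
  refine ⟨φ, hφ, h, ⟨hmeas, fun k x => isClosed_Icc.mem_of_tendsto (hh k x)
    (Eventually.of_forall fun n => hu01 _ _ _), fun k x => ?_⟩, hh⟩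
  have hlim : Tendsto (fun n => ∫ y, u (φ n) (k + 1) y ∂T x) atTop (𝓝 (∫ y, h (k + 1) y ∂T x)) :=
    tendsto_integral_of_dominated_convergence (fun _ => 1)
      (fun n => (hu _ _).aestronglyMeasurable) (integrable_const _)
      (fun n => ae_of_all _ fun y => by
        rw [Real.norm_eq_abs, abs_of_nonneg (hu01 _ _ _).1]; exact (hu01 _ _ _).2)
      (ae_of_all _ fun y => hh (k + 1) y)
  refine tendsto_nhds_unique ((hh k x).congr' ?_) hlim
  filter_upwards [hharm' k] with n hn using hn x

end Kernels

/-! ### Deterministic factors of an ergodic chain -/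

section Ergodic

variable {α : Type*} [MeasurableSpace α]

/-- Absolute continuity gives the law of G an atom, invariance spreads its mass along the S-orbit,
and finiteness of π makes the orbit periodic. Aperiodicity reduces the period to 1, and
irreducibility lets the resulting closed fibre fill the space. -/
lemma exists_ae_eq_const_of_forall_ae_eq {Ω : Type*} [MeasurableSpace Ω]
    [MeasurableSingletonClass Ω] {T : Kernel α α} [IsMarkovKernel T] {π φ : Measure α}
    [IsProbabilityMeasure π] (hac : ∀ x, T x ≪ π) (hπφ : π ≪ φ) (hinv : T.Invariant π)
    (herg : IsErgodicChain φ T) {G : α → Ω} (hG : Measurable G) {S : Ω → Ω}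
    (hS : Function.Injective S) (hGS : ∀ᵐ x ∂π, ∀ᵐ y ∂T x, G y = S (G x)) :
    ∃ ω, ∀ᵐ x ∂π, G x = ω := by
  obtain ⟨A, hsub, hA, hA0⟩ := exists_measurable_superset_of_null (ae_iff.1 hGS)
  have hgood : ∀ x ∈ Aᶜ, ∀ᵐ y ∂T x, G y = S (G x) := fun x hx => by
    by_contra hc
    exact hx (hsub hc)
  have hTA : ∀ x, ∀ᵐ y ∂T x, y ∈ Aᶜ := fun x => compl_mem_ae_iff.2 (hac x hA0)
  have hAπ : ∀ᵐ x ∂π, x ∈ Aᶜ := compl_mem_ae_iff.2 hA0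
  have hfib : ∀ ω, MeasurableSet (G ⁻¹' {ω}) := fun ω => hG (measurableSet_singleton ω)
  obtain ⟨x₀, hx₀⟩ := hAπ.exists
  set ω := S (G x₀)
  -- One step from x₀ lands almost surely in this fibre, and `T x₀ ≪ π`.
  have hpos : 0 < π (G ⁻¹' {ω}) := by
    refine pos_iff_ne_zero.2 fun h0 => ?_
    have h1 : T x₀ (G ⁻¹' {ω}) = 0 := hac x₀ h0
    have h2 : ∀ᵐ y ∂T x₀, y ∈ (G ⁻¹' {ω})ᶜ := compl_mem_ae_iff.2 h1
    obtain ⟨y, hy, hy'⟩ := ((hgood x₀ hx₀).and h2).exists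
    exact hy' hy
  -- As S is injective, the fibre over S ω' is entered almost surely from the fibre over ω' and
  -- almost never from elsewhere.
  have hstep : ∀ ω', π (G ⁻¹' {S ω'}) = π (G ⁻¹' {ω'}) := by
    intro ω'
    conv_lhs => rw [← hinv.def]
    rw [Measure.bind_apply (hfib _) T.aemeasurable, ← lintegral_indicator_one (hfib ω')]
    refine lintegral_congr_ae ?_
    filter_upwards [hAπ] with x hx
    by_cases hxω : G x = ω'
    · rw [Set.indicator_of_mem (by exact hxω), Pi.one_apply, ← mem_ae_iff_prob_eq_one (hfib _)]
      filter_upwards [hgood x hx] with y hy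
      rw [hxω] at hy
      exact hy
    · rw [Set.indicator_of_notMem (by exact hxω), measure_eq_zero_iff_ae_notMem]
      filter_upwards [hgood x hx] with y hy hy'
      exact hxω (hS (hy.symm.trans hy'))
  have hiter : ∀ n : ℕ, π (G ⁻¹' {S^[n] ω}) = π (G ⁻¹' {ω}) := by
    intro n
    induction n with
    | zero => rfl
    | succ n ih => rw [Function.iterate_succ_apply', hstep, ih]
  -- Otherwise infinitely many disjoint fibres would share the same positive mass.
  have hper : ω ∈ Function.periodicPts S := by
    by_contra hnot
    have hinj : Function.Injective fun n : ℕ => S^[n] ω := by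
      intro m n hmn
      by_contra hne
      wlog hlt : m < n generalizing m n
      · exact this hmn.symm (Ne.symm hne) (by omega)
      refine hnot ⟨n - m, by omega, ?_⟩
      refine hS.iterate m ?_
      rw [← Function.iterate_add_apply]
      have : m + (n - m) = n := by omega
      rw [this]
      exact hmn.symm
    have hsum : ∑' n : ℕ, π (G ⁻¹' {S^[n] ω}) ≤ 1 := by
      rw [← measure_iUnion (fun m n hmn => ?_) fun n => hfib _]
      · exact prob_le_one
      · exact Disjoint.preimage G (Set.disjoint_singleton.2 fun h => hmn (hinj h))
    simp_rw [hiter] at hsum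
    rw [ENNReal.tsum_const_eq_top_of_ne_zero hpos.ne'] at hsum
    exact absurd hsum (by simp)
  have hd : 0 < Function.minimalPeriod S ω := Function.minimalPeriod_pos_of_mem_periodicPts hper
  have hD : ∀ n : ℕ, ∀ x ∈ G ⁻¹' {S^[n] ω} ∩ Aᶜ, T x (G ⁻¹' {S^[n + 1] ω} ∩ Aᶜ) = 1 := by
    rintro n x ⟨hx, hxA⟩
    rw [← mem_ae_iff_prob_eq_one ((hfib _).inter hA.compl)]
    filter_upwards [hgood x hxA, hTA x] with y hy hyA
    refine ⟨?_, hyA⟩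
    rw [Set.mem_preimage, Set.mem_singleton_iff] at hx ⊢
    rw [hy, hx, Function.iterate_succ_apply']
  have hfibA : ∀ n, π (G ⁻¹' {S^[n] ω} ∩ Aᶜ) = π (G ⁻¹' {ω}) := fun n => by
    rw [← hiter n]
    exact measure_inter_conull (by rwa [compl_compl])
  -- A longer period would make the fibres over the orbit a forbidden cycle; removing A makes each
  -- transition hold from every point.
  have hd1 : Function.minimalPeriod S ω = 1 := by
    by_contra hne
    refine herg.aperiodic ⟨Function.minimalPeriod S ω, by omega, ?_⟩
    have : NeZero (Function.minimalPeriod S ω) := ⟨hd.ne'⟩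
    have : Fact (1 < Function.minimalPeriod S ω) := ⟨by omega⟩
    refine ⟨fun i => G ⁻¹' {S^[i.val] ω} ∩ Aᶜ, fun i => (hfib _).inter hA.compl,
      fun i j hij => ?_, fun i => ?_, fun i x hx => ?_⟩
    · refine Disjoint.mono Set.inter_subset_left Set.inter_subset_left
        (Disjoint.preimage G (Set.disjoint_singleton.2 fun h => hij ?_))
      exact ZMod.val_injective _
        (Function.iterate_injOn_Iio_minimalPeriod (ZMod.val_lt i) (ZMod.val_lt j) h)
    · refine pos_iff_ne_zero.2 fun h0 => hpos.ne' ?_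
      rw [← hfibA i.val]
      exact hπφ h0
    · have := hD i.val x hx
      beta_reduce
      rwa [ZMod.val_add, ZMod.val_one, Function.iterate_mod_minimalPeriod_eq]
  have hSω : S ω = ω := Function.minimalPeriod_eq_one_iff_isFixedPt.1 hd1
  -- W is closed under the chain, so its complement is unreachable from W and must be φ-null.
  set W := G ⁻¹' {ω} ∩ Aᶜ with hW
  have hWm : MeasurableSet W := (hfib _).inter hA.compl
  have hTW : ∀ x ∈ W, T x Wᶜ = 0 := by
    intro x hx
    have := hD 0 x hx
    rw [prob_compl_eq_zero_iff hWm]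
    simpa [hSω] using this
  have hTnW : ∀ n : ℕ, ∀ x ∈ W, (T ^ n) x Wᶜ = 0 := by
    intro n
    induction n with
    | zero =>
      intro x hx
      have : (T ^ 0) x = Measure.dirac x := Kernel.id_apply x
      rw [this, Measure.dirac_apply' _ hWm.compl]
      simpa using hx
    | succ n ih =>
      intro x hx
      rw [Kernel.pow_succ_apply_eq_lintegral _ _ _ hWm.compl, lintegral_eq_zero_iff
        (T.measurable_coe hWm.compl)]
      filter_upwards [compl_mem_ae_iff.2 (ih x hx)] with y hy
      exact hTW y (by simpa using hy)
  have hWpos : π W ≠ 0 := by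
    have := hfibA 0
    rw [Function.iterate_zero, id] at this
    rw [this]
    exact hpos.ne'
  obtain ⟨x, hx⟩ := nonempty_of_measure_ne_zero hWpos
  have hφW : φ Wᶜ = 0 := by
    by_contra h0
    obtain ⟨n, hn⟩ := herg.irreducible.irreducible hWm.compl (pos_iff_ne_zero.2 h0) x
    exact hn.ne' (hTnW n x hx)
  refine ⟨ω, ?_⟩
  filter_upwards [compl_mem_ae_iff.2 (hπφ hφW)] with y hy
  have hy : y ∈ W := by simpa using hy
  exact hy.1

end Ergodic

/-! ### Rigidity of space-time harmonic functions -/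

section Harmonic

variable {α : Type*} [MeasurableSpace α]

lemma sq_mem_Icc {r : ℝ} (h : r ∈ Set.Icc (0 : ℝ) 1) : r ^ 2 ∈ Set.Icc (0 : ℝ) 1 :=
  ⟨sq_nonneg r, pow_le_one₀ h.1 h.2⟩

lemma integral_sub_sq {μ : Measure α} [IsProbabilityMeasure μ] {f : α → ℝ}
    (hf : Measurable f) (h : ∀ x, f x ∈ Set.Icc (0 : ℝ) 1) (c : ℝ) :
    ∫ x, (f x - c) ^ 2 ∂μ = ∫ x, f x ^ 2 ∂μ - 2 * c * ∫ x, f x ∂μ + c ^ 2 := by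
  have h1 : Integrable (fun x => f x ^ 2) μ :=
    integrable_of_mem_Icc (hf.pow_const 2) fun x => sq_mem_Icc (h x)
  have h2 : Integrable (fun x => 2 * c * f x) μ := (integrable_of_mem_Icc hf h).const_mul _
  have : ∀ x, (f x - c) ^ 2 = f x ^ 2 - 2 * c * f x + c ^ 2 := fun x => by ring
  simp_rw [this]
  have h3 : Integrable (fun x => f x ^ 2 - 2 * c * f x) μ := h1.sub h2
  rw [integral_add h3 (integrable_const _), integral_sub h1 h2, integral_const_mul]
  simp

lemma ae_eq_const_of_integral_sub_sq_le_zero {μ : Measure α} [IsProbabilityMeasure μ] {f : α → ℝ}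
    (hf : Measurable f) (h : ∀ x, f x ∈ Set.Icc (0 : ℝ) 1) {c : ℝ}
    (h0 : ∫ x, (f x - c) ^ 2 ∂μ ≤ 0) : ∀ᵐ x ∂μ, f x = c := by
  have hint : Integrable (fun x => (f x - c) ^ 2) μ := by
    have h1 : Integrable (fun x => f x ^ 2) μ :=
      integrable_of_mem_Icc (hf.pow_const 2) fun x => sq_mem_Icc (h x)
    have h2 : Integrable (fun x => 2 * c * f x) μ := (integrable_of_mem_Icc hf h).const_mul _
    refine ((h1.sub h2).add (integrable_const (c ^ 2))).congr (ae_of_all _ fun x => ?_)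
    simp only [Pi.add_apply, Pi.sub_apply]
    ring
  have h1 : ∫ x, (f x - c) ^ 2 ∂μ = 0 := le_antisymm h0 (integral_nonneg fun x => sq_nonneg _)
  filter_upwards [(integral_eq_zero_iff_of_nonneg (fun x => sq_nonneg _) hint).1 h1] with x hx
  have : (f x - c) ^ 2 = 0 := hx
  linarith [pow_eq_zero_iff (two_ne_zero) |>.1 this]

lemma IsSpaceTimeHarmonic.sq_mem {T : Kernel α α} {h : ℤ → α → ℝ} (hh : IsSpaceTimeHarmonic T h)
    (k : ℤ) (x : α) : h k x ^ 2 ∈ Set.Icc (0 : ℝ) 1 :=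
  sq_mem_Icc (hh.mem_Icc k x)

variable {T : Kernel α α} [IsMarkovKernel T] {π φ : Measure α} [IsProbabilityMeasure π]

lemma integral_integral_of_invariant (hinv : T.Invariant π) {f : α → ℝ}
    (hf : Measurable f) (h : ∀ x, f x ∈ Set.Icc (0 : ℝ) 1) :
    ∫ x, ∫ y, f y ∂T x ∂π = ∫ x, f x ∂π := by
  have := integral_comp_measure T π (f := f) (integrable_of_mem_Icc hf h)
  rw [← this, hinv.def]

lemma sq_integral_le {μ : Measure α} [IsProbabilityMeasure μ] {f : α → ℝ}
    (hf : Measurable f) (h : ∀ x, f x ∈ Set.Icc (0 : ℝ) 1) :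
    (∫ x, f x ∂μ) ^ 2 ≤ ∫ x, f x ^ 2 ∂μ := by
  have h1 := integral_sub_sq (μ := μ) hf h (∫ x, f x ∂μ)
  have h2 : 0 ≤ ∫ x, (f x - ∫ x, f x ∂μ) ^ 2 ∂μ := integral_nonneg fun x => sq_nonneg _
  nlinarith

namespace IsSpaceTimeHarmonic

variable {h : ℤ → α → ℝ}

lemma sq_le_integral_sq (hh : IsSpaceTimeHarmonic T h) (k : ℤ) (x : α) :
    h k x ^ 2 ≤ ∫ y, h (k + 1) y ^ 2 ∂T x := by
  rw [hh.eq_integral k x]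
  exact sq_integral_le (hh.measurable _) (hh.mem_Icc _)

lemma integral_succ (hh : IsSpaceTimeHarmonic T h) (hinv : T.Invariant π) (k : ℤ) :
    ∫ x, h (k + 1) x ∂π = ∫ x, h k x ∂π := by
  rw [← integral_integral_of_invariant hinv (hh.measurable _) (hh.mem_Icc _)]
  simp_rw [← hh.eq_integral]

lemma integral_eq (hh : IsSpaceTimeHarmonic T h) (hinv : T.Invariant π) (k : ℤ) :
    ∫ x, h k x ∂π = ∫ x, h 0 x ∂π := by
  induction k using Int.induction_on with
  | zero => rfl
  | succ i ih => rw [hh.integral_succ hinv, ih]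
  | pred i ih =>
    rw [← ih, ← hh.integral_succ hinv (-(i : ℤ) - 1)]
    simp

lemma monotone_integral_sq (hh : IsSpaceTimeHarmonic T h) (hinv : T.Invariant π) :
    Monotone fun k => ∫ x, h k x ^ 2 ∂π := by
  refine monotone_int_of_le_succ fun k => ?_
  have hm : Measurable fun x => h (k + 1) x ^ 2 := (hh.measurable _).pow_const 2
  rw [← integral_integral_of_invariant hinv hm (hh.sq_mem _)]
  exact integral_mono (integrable_of_mem_Icc ((hh.measurable _).pow_const 2) (hh.sq_mem _))
    (integrable_of_mem_Icc (measurable_integral_kernel T hm)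
      fun x => integral_mem_Icc hm (hh.sq_mem _)) fun x => hh.sq_le_integral_sq k x

/-- Equality of energies is equality in Jensen's inequality for π-almost every x: the variance of `h
(k + 1)` under `T x` vanishes. -/
lemma ae_ae_eq (hh : IsSpaceTimeHarmonic T h) (hinv : T.Invariant π) {k : ℤ}
    (hk : ∫ x, h (k + 1) x ^ 2 ∂π = ∫ x, h k x ^ 2 ∂π) :
    ∀ᵐ x ∂π, ∀ᵐ y ∂T x, h (k + 1) y = h k x := by
  have hm : Measurable fun x => h (k + 1) x ^ 2 := (hh.measurable _).pow_const 2
  have hi1 : Integrable (fun x => ∫ y, h (k + 1) y ^ 2 ∂T x) π :=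
    integrable_of_mem_Icc (measurable_integral_kernel T hm)
      fun x => integral_mem_Icc hm (hh.sq_mem _)
  have hi2 : Integrable (fun x => h k x ^ 2) π :=
    integrable_of_mem_Icc ((hh.measurable _).pow_const 2) (hh.sq_mem _)
  have h0 : ∫ x, (∫ y, h (k + 1) y ^ 2 ∂T x - h k x ^ 2) ∂π = 0 := by
    rw [integral_sub hi1 hi2, integral_integral_of_invariant hinv hm (hh.sq_mem _), hk, sub_self]
  have hnn : 0 ≤ fun x => ∫ y, h (k + 1) y ^ 2 ∂T x - h k x ^ 2 :=
    fun x => sub_nonneg.2 (hh.sq_le_integral_sq k x)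
  filter_upwards [(integral_eq_zero_iff_of_nonneg hnn (hi1.sub hi2)).1 h0] with x hx
  have hx : ∫ y, h (k + 1) y ^ 2 ∂T x - h k x ^ 2 = 0 := hx
  refine ae_eq_const_of_integral_sub_sq_le_zero (hh.measurable _) (hh.mem_Icc _) ?_
  rw [integral_sub_sq (hh.measurable _) (hh.mem_Icc _), ← hh.eq_integral]
  nlinarith

theorem eq_of_isErgodicChain [MeasurableSpace.CountablyGenerated α]
    (hh : IsSpaceTimeHarmonic T h) (hac : ∀ x, T x ≪ π) (hπφ : π ≪ φ)
    (hinv : T.Invariant π) (herg : IsErgodicChain φ T) (k : ℤ) (x : α) :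
    h k x = ∫ y, h 0 y ∂π := by
  obtain ⟨ψ, hψ, g, hg, hlim⟩ := exists_subseq_tendsto_isSpaceTimeHarmonic hac
    (u := fun n k => h (k + n)) (fun n k => hh.measurable _) (fun n k => hh.mem_Icc _)
    (fun k => Eventually.of_forall fun n x => by
      rw [hh.eq_integral]
      simp only [add_right_comm])
  have hmono := hh.monotone_integral_sq hinv
  have hsq : ∀ k, Tendsto (fun n => ∫ x, h (k + (ψ n : ℕ)) x ^ 2 ∂π) atTop
      (𝓝 (∫ x, g k x ^ 2 ∂π)) := fun k =>
    tendsto_integral_of_dominated_convergence (fun _ => 1)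
      (fun n => ((hh.measurable _).pow_const 2).aestronglyMeasurable) (integrable_const _)
      (fun n => ae_of_all _ fun y => by
        rw [Real.norm_eq_abs, abs_of_nonneg (hh.sq_mem _ _).1]; exact (hh.sq_mem _ _).2)
      (ae_of_all _ fun y => (hlim k y).pow 2)
  have hbdd : BddAbove (Set.range fun k => ∫ x, h k x ^ 2 ∂π) := by
    refine ⟨1, ?_⟩
    rintro _ ⟨k, rfl⟩
    exact (integral_mem_Icc ((hh.measurable k).pow_const 2) (hh.sq_mem k)).2
  have hL := tendsto_atTop_ciSup hmono hbdd
  -- The shifts go forward in time, so every energy of g equals the limit of the monotone energies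
  -- of h.
  have hgL : ∀ k, ∫ x, g k x ^ 2 ∂π = ⨆ k, ∫ x, h k x ^ 2 ∂π := fun k =>
    tendsto_nhds_unique (hsq k) (hL.comp (tendsto_atTop_add_const_left _ k
      (tendsto_natCast_atTop_atTop.comp hψ.tendsto_atTop)))
  have hrigid : ∀ᵐ x ∂π, ∀ᵐ y ∂T x,
      (fun k => g k y) = (fun ω : ℤ → ℝ => fun k => ω (k - 1)) (fun k => g k x) := by
    have : ∀ᵐ x ∂π, ∀ k, ∀ᵐ y ∂T x, g (k + 1) y = g k x :=
      ae_all_iff.2 fun k => hg.ae_ae_eq hinv (by rw [hgL, hgL])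
    filter_upwards [this] with x hx
    filter_upwards [ae_all_iff.2 hx] with y hy
    funext k
    have := hy (k - 1)
    rwa [sub_add_cancel] at this
  have hinj : Function.Injective (fun ω : ℤ → ℝ => fun k => ω (k - 1)) := by
    intro ω ω' hω
    funext k
    have := congrFun hω (k + 1)
    simpa using this
  obtain ⟨ω, hω⟩ := exists_ae_eq_const_of_forall_ae_eq hac hπφ hinv herg
    (G := fun x k => g k x) (measurable_pi_lambda _ hg.measurable) hinj hrigid
  have hω0 : ∀ᵐ x ∂π, g 0 x = ω 0 := hω.mono fun x hx => congrFun hx 0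
  set m := ∫ y, h 0 y ∂π
  have hgm : ∫ x, g 0 x ∂π = m := by
    refine tendsto_nhds_unique (tendsto_integral_of_dominated_convergence (fun _ => 1)
      (fun n => (hh.measurable _).aestronglyMeasurable) (integrable_const _)
      (fun n => ae_of_all _ fun y => by
        rw [Real.norm_eq_abs, abs_of_nonneg (hh.mem_Icc _ _).1]; exact (hh.mem_Icc _ _).2)
      (ae_of_all _ fun y => hlim 0 y)) ?_
    simp_rw [hh.integral_eq hinv]
    exact tendsto_const_nhds
  have hωm : ω 0 = m := by
    rw [← hgm, integral_congr_ae hω0]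
    simp
  have hLm : ⨆ k, ∫ x, h k x ^ 2 ∂π = m ^ 2 := by
    rw [← hgL 0, integral_congr_ae (g := fun _ => m ^ 2)
      (hω0.mono fun x hx => by simp only [hx, hωm])]
    simp
  -- The variance is an energy minus m², and no energy exceeds the supremum m².
  have hae : ∀ᵐ y ∂π, h (k + 1) y = m := by
    refine ae_eq_const_of_integral_sub_sq_le_zero (hh.measurable _) (hh.mem_Icc _) ?_
    rw [integral_sub_sq (hh.measurable _) (hh.mem_Icc _), hh.integral_eq hinv]
    have := le_ciSup hbdd (k + 1)
    rw [hLm] at this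
    nlinarith
  -- Averaging over `T x ≪ π` upgrades almost everywhere at time k + 1 to everywhere at time k.
  rw [hh.eq_integral, integral_congr_ae ((hac x).ae_le hae)]
  simp

end IsSpaceTimeHarmonic

end Harmonic

/-! ### Convergence in total variation -/

section Convergence

variable {α : Type*} [MeasurableSpace α]

instance isProbabilityMeasure_chainLaw (T : Kernel α α) [IsMarkovKernel T] (μ : Measure α)
    [IsProbabilityMeasure μ] (n : ℕ) : IsProbabilityMeasure (chainLaw T μ n) := by
  unfold chainLaw
  infer_instance

lemma chainLaw_eq_of_invariant {T : Kernel α α} {μ : Measure α} (hinv : T.Invariant μ) (n : ℕ) :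
    chainLaw T μ n = μ := by
  induction n with
  | zero =>
    have : T ^ 0 = Kernel.id := rfl
    rw [chainLaw, this, Measure.id_comp]
  | succ n ih =>
    have hpow : T ^ (n + 1) = (T ^ n) ∘ₖ T := pow_succ T n
    rw [chainLaw] at ih ⊢
    rw [hpow, ← Measure.comp_assoc, hinv.def, ih]

lemma bddAbove_range_abs_real_sub (μ ν : Measure α) [IsProbabilityMeasure μ]
    [IsProbabilityMeasure ν] :
    BddAbove (Set.range fun A : {A : Set α // MeasurableSet A} => |μ.real A - ν.real A|) := by
  refine ⟨1, ?_⟩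
  rintro _ ⟨A, rfl⟩
  have h1 := measureReal_nonneg (μ := μ) (s := A.1)
  have h2 := measureReal_nonneg (μ := ν) (s := A.1)
  have h3 := measureReal_le_one (μ := μ) (s := A.1)
  have h4 := measureReal_le_one (μ := ν) (s := A.1)
  exact abs_le.2 ⟨by linarith, by linarith⟩

lemma tvDist_nonneg (μ ν : Measure α) : 0 ≤ tvDist μ ν :=
  Real.iSup_nonneg fun _ => abs_nonneg _

lemma eq_of_tvDist_le_zero {μ ν : Measure α} [IsProbabilityMeasure μ] [IsProbabilityMeasure ν]
    (h : tvDist μ ν ≤ 0) : μ = ν := by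
  ext A hA
  have h1 := (le_ciSup (bddAbove_range_abs_real_sub μ ν) ⟨A, hA⟩).trans h
  have h2 : μ.real A - ν.real A = 0 := abs_eq_zero.1 (le_antisymm h1 (abs_nonneg _))
  exact (measureReal_eq_measureReal_iff).1 (sub_eq_zero.1 h2)

lemma exists_measurableSet_lt_real_sub {μ ν : Measure α} [IsProbabilityMeasure μ]
    [IsProbabilityMeasure ν] {ε : ℝ} (h : ε < tvDist μ ν) :
    ∃ A, MeasurableSet A ∧ ε < μ.real A - ν.real A := by
  have : Nonempty {A : Set α // MeasurableSet A} := ⟨⟨∅, MeasurableSet.empty⟩⟩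
  obtain ⟨⟨A, hA⟩, h⟩ := exists_lt_of_lt_ciSup h
  rcases lt_abs.1 h with h | h
  · exact ⟨A, hA, h⟩
  · refine ⟨Aᶜ, hA.compl, ?_⟩
    rw [probReal_compl_eq_one_sub hA, probReal_compl_eq_one_sub hA]
    dsimp only at h
    linarith

theorem tendsto_tvDist_chainLaw [MeasurableSpace.CountablyGenerated α]
    {T : Kernel α α} [IsMarkovKernel T] {π φ : Measure α} [IsProbabilityMeasure π]
    (hac : ∀ x, T x ≪ π) (hπφ : π ≪ φ) (hinv : T.Invariant π) (herg : IsErgodicChain φ T)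
    (μ : Measure α) [IsProbabilityMeasure μ] :
    Tendsto (fun t => tvDist (chainLaw T μ t) π) atTop (𝓝 0) := by
  by_contra hnot
  rw [Metric.tendsto_atTop] at hnot
  push Not at hnot
  obtain ⟨ε, hε, hfreq⟩ := hnot
  have hsets : ∀ N : ℕ, ∃ n ≥ N, ∃ A, MeasurableSet A ∧
      ε / 2 < (chainLaw T μ n).real A - π.real A := by
    intro N
    obtain ⟨n, hn, h⟩ := hfreq N
    rw [Real.dist_eq, sub_zero, abs_of_nonneg (tvDist_nonneg _ _)] at h
    exact ⟨n, hn, exists_measurableSet_lt_real_sub (by linarith)⟩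
  choose n hn A hA hgap using hsets
  let f : ℕ → α → ℝ := fun N => (A N).indicator 1
  have hf : ∀ N, Measurable (f N) := fun N => measurable_one.indicator (hA N)
  have hf01 : ∀ N x, f N x ∈ Set.Icc (0 : ℝ) 1 := fun N x => by
    by_cases hx : x ∈ A N <;> simp [f, hx]
  obtain ⟨ψ, hψ, h, hh, hlim⟩ := exists_subseq_tendsto_isSpaceTimeHarmonic hac
    (u := fun N k x => ∫ y, f N y ∂(T ^ ((n N : ℤ) - k).toNat) x)
    (fun N k => measurable_integral_kernel _ (hf N))
    (fun N k x => integral_mem_Icc (hf N) (hf01 N)) (fun k => by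
      -- Harmonicity at time k needs only `n N ≥ k + 1`, where the exponents are not truncated by
      -- `toNat`.
      filter_upwards [eventually_ge_atTop (k + 1).toNat] with N hN x
      have h1 := hn N
      have : ((n N : ℤ) - k).toNat = ((n N : ℤ) - (k + 1)).toNat + 1 := by omega
      rw [this, integral_pow_succ T _ _ (hf N) (hf01 N)])
  have hint : ∀ ν : Measure α, IsProbabilityMeasure ν →
      Tendsto (fun N => (chainLaw T ν (n (ψ N))).real (A (ψ N))) atTop (𝓝 (∫ x, h 0 x ∂ν)) := by
    intro ν _
    have h1 : Tendsto (fun N => ∫ x, ∫ y, f (ψ N) y ∂(T ^ ((n (ψ N) : ℤ) - 0).toNat) x ∂ν) atTop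
        (𝓝 (∫ x, h 0 x ∂ν)) :=
      tendsto_integral_of_dominated_convergence (fun _ => 1)
        (fun N => (measurable_integral_kernel _ (hf _)).aestronglyMeasurable) (integrable_const _)
        (fun N => ae_of_all _ fun x => by
          have := integral_mem_Icc (μ := (T ^ ((n (ψ N) : ℤ) - 0).toNat) x) (hf (ψ N)) (hf01 (ψ N))
          rw [Real.norm_eq_abs, abs_of_nonneg this.1]; exact this.2)
        (ae_of_all _ fun x => hlim 0 x)
    refine h1.congr fun N => ?_
    have : ((n (ψ N) : ℤ) - 0).toNat = n (ψ N) := by omega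
    rw [this, ← integral_comp_measure _ _ (integrable_of_mem_Icc (hf _) (hf01 _)),
      integral_indicator_one (hA _), chainLaw]
  have hπ := hint π inferInstance
  simp_rw [chainLaw_eq_of_invariant hinv] at hπ
  have hle := ge_of_tendsto ((hint μ inferInstance).sub hπ)
    (Eventually.of_forall fun N => (hgap (ψ N)).le)
  have hμ : ∫ x, h 0 x ∂μ = ∫ x, h 0 x ∂π := by
    rw [integral_congr_ae (ae_of_all μ (hh.eq_of_isErgodicChain hac hπφ hinv herg 0))]
    simp
  rw [hμ, sub_self] at hle
  linarith

/-- By invariance, a π-null set is missed at all times from almost every starting point;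
irreducibility forbids this for a set of positive φ-measure. -/
lemma absolutelyContinuous_of_isIrreducible {T : Kernel α α} {π φ : Measure α}
    (hinv : T.Invariant π) [hirr : Kernel.IsIrreducible φ T] [NeZero π] : φ ≪ π := by
  refine Measure.AbsolutelyContinuous.mk fun A hA h0 => ?_
  by_contra hφ
  have h1 : ∀ n, ∀ᵐ x ∂π, (T ^ n) x A = 0 := by
    intro n
    have h2 : chainLaw T π n A = 0 := by rw [chainLaw_eq_of_invariant hinv, h0]
    rw [chainLaw, Measure.bind_apply hA (T ^ n).aemeasurable,
      lintegral_eq_zero_iff ((T ^ n).measurable_coe hA)] at h2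
    exact h2
  obtain ⟨x, hx⟩ := (ae_all_iff.2 h1).exists
  obtain ⟨n, hn⟩ := hirr.irreducible hA (pos_iff_ne_zero.2 hφ) x
  exact hn.ne' (hx n)

/-- An ergodic chain whose transition probabilities are absolutely continuous with respect to the
reference measure converges to its stationary distribution. -/
theorem IsErgodicChain.convergesToStationary [MeasurableSpace.CountablyGenerated α]
    {T : Kernel α α} [IsMarkovKernel T] {π φ : Measure α} [IsProbabilityMeasure π]
    (herg : IsErgodicChain φ T) (hac : ∀ x, T x ≪ φ) (hinv : T.Invariant π) :
    ConvergesToStationary T π := by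
  have := herg.irreducible
  have hφπ : φ ≪ π := absolutelyContinuous_of_isIrreducible hinv
  have hπφ : π ≪ φ := by
    refine Measure.AbsolutelyContinuous.mk fun A hA h0 => ?_
    rw [← hinv.def, Measure.bind_apply hA T.aemeasurable]
    simp [hac _ h0]
  have hconv := tendsto_tvDist_chainLaw (fun x => (hac x).trans hφπ) hπφ hinv herg
  refine ⟨hinv, fun π' _ hinv' => ?_, fun μ _ => hconv μ⟩
  -- The chain started from π' keeps the law π', so its distance to π is constant in time and tends
  -- to 0.
  have h1 := hconv π'
  simp_rw [chainLaw_eq_of_invariant hinv'] at h1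
  exact eq_of_tvDist_le_zero (tendsto_nhds_unique tendsto_const_nhds h1).le

/-- A chain with strictly positive one-step transition probabilities is ergodic. -/
lemma isErgodicChain_of_forall_pos {T : Kernel α α} [IsMarkovKernel T] {φ : Measure α}
    (hpos : ∀ x A, MeasurableSet A → 0 < φ A → 0 < T x A) : IsErgodicChain φ T := by
  refine ⟨⟨fun A hA hφ x => ⟨1, by rw [pow_one]; exact hpos x A hA hφ⟩⟩, ?_⟩
  rintro ⟨d, hd, D, hD, hdisj, hDpos, hstep⟩
  have : Fact (1 < d) := ⟨hd⟩
  obtain ⟨x, hx⟩ := nonempty_of_measure_ne_zero (hDpos 0).ne'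
  have h1 : T x (D (0 + 1))ᶜ = 0 := (prob_compl_eq_zero_iff (hD _)).2 (hstep 0 x hx)
  have h2 : T x (D 0) = 0 :=
    measure_mono_null (hdisj (by simp)).subset_compl_right h1
  exact (hpos x _ (hD 0) (hDpos 0)).ne' h2

end Convergence

/-! ### Application to autoencoders -/

section Autoencoder

variable {b : ℕ} {𝒳 𝒴 : Type*} [MeasurableSpace 𝒳] [MeasurableSpace 𝒴]
  {refX : Measure 𝒳} {refZ : Measure (Latent b)} {P : Kernel (Latent b) 𝒳}
  {p : Latent b → 𝒳 → ℝ≥0∞}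

lemma IsDecoderDensity.absolutelyContinuous (hp : IsDecoderDensity refX P p) (z : Latent b) :
    P z ≪ refX := by
  rw [hp.2 z]
  exact withDensity_absolutelyContinuous _ _

lemma IsDecoderDensity.absolutelyContinuous_of_positive (hp : IsDecoderDensity refX P p)
    (hpos : DecoderPositive refX p) (z : Latent b) : refX ≪ P z := by
  rw [hp.2 z]
  exact withDensity_absolutelyContinuous' (hp.1.of_uncurry_left).aemeasurable
    ((hpos z).mono fun x hx => hx.ne')

lemma transition_absolutelyContinuous (hp : IsDecoderDensity refX P p)
    {Q : Kernel 𝒳 (Latent b)} (hQ : EncoderNonsingular refX refZ Q) (z : Latent b) :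
    transition Q P z ≪ refZ := by
  refine Measure.AbsolutelyContinuous.mk fun N hN h0 => ?_
  rw [transition, Kernel.comp_apply' _ _ _ hN, lintegral_eq_zero_iff (Q.measurable_coe hN)]
  exact (hp.absolutelyContinuous z).ae_le (hQ N hN h0)

/-- A transition probability 0 into B means Q x B = 0 for `P z`-almost every x, hence for
`refX`-almost every x, since a positive density gives `refX ≪ P z`. -/
lemma isErgodicChain_transition (hp : IsDecoderDensity refX P p) [IsMarkovKernel P]
    {Q : Kernel 𝒳 (Latent b)} [IsMarkovKernel Q] (hpos : DecoderPositive refX p)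
    (hQ : EncoderPositive refX refZ Q) : IsErgodicChain refZ (transition Q P) := by
  have : IsMarkovKernel (transition Q P) := by unfold transition; infer_instance
  refine isErgodicChain_of_forall_pos fun z B hB hB0 => pos_iff_ne_zero.2 fun h0 => ?_
  rw [transition, Kernel.comp_apply' _ _ _ hB, lintegral_eq_zero_iff (Q.measurable_coe hB)] at h0
  refine (hQ B hB hB0).ne' ?_
  have h1 := (hp.absolutelyContinuous_of_positive hpos z).ae_le h0
  refine measure_mono_null (fun x hx => ?_) (ae_iff.1 h1)
  exact (show 0 < Q x B from hx).ne'

lemma transition_invariant {Q : Kernel 𝒳 (Latent b)} {data : Measure 𝒳}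
    (h : DecodesTo P (learnedLatent Q data) data) :
    (transition Q P).Invariant (learnedLatent Q data) := by
  have h : P ∘ₘ learnedLatent Q data = data := h
  rw [Kernel.Invariant, transition, ← Measure.comp_assoc, h, learnedLatent]

lemma EncoderNonsingular.comp {C : Kernel 𝒳 𝒴} {Q : Kernel 𝒴 (Latent b)}
    (h : EncoderNonsingular (C ∘ₘ refX) refZ Q) : EncoderNonsingular refX refZ (Q ∘ₖ C) := by
  intro N hN h0
  filter_upwards [Measure.ae_ae_of_ae_comp (h N hN h0)] with x hx
  rw [Kernel.comp_apply' _ _ _ hN]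
  exact (lintegral_eq_zero_iff (Q.measurable_coe hN)).2 hx

/-- If (Q ∘ₖ C) x B = 0, then Q y B = 0 for `C x`-almost every y; were this so for `refX`-almost
every x, the inputs y with Q y B > 0 would be null for the image measure. -/
lemma EncoderPositive.comp {C : Kernel 𝒳 𝒴} {Q : Kernel 𝒴 (Latent b)}
    (h : EncoderPositive (C ∘ₘ refX) refZ Q) : EncoderPositive refX refZ (Q ∘ₖ C) := by
  intro B hB hB0
  refine pos_iff_ne_zero.2 fun h0 => (h B hB hB0).ne' ?_
  have hm : MeasurableSet {y | 0 < Q y B} := measurableSet_lt measurable_const (Q.measurable_coe hB)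
  rw [Measure.bind_apply hm C.aemeasurable, lintegral_eq_zero_iff (C.measurable_coe hm)]
  filter_upwards [measure_eq_zero_iff_ae_notMem.1 h0] with x hx
  have hx : (Q ∘ₖ C) x B = 0 := by simpa using hx
  rw [Kernel.comp_apply' _ _ _ hB, lintegral_eq_zero_iff (Q.measurable_coe hB)] at hx
  refine measure_mono_null (fun y hy => ?_) (ae_iff.1 hx)
  exact (show 0 < Q y B from hy).ne'

theorem generativeAutoencoder_convergence (data : Measure 𝒳) [IsProbabilityMeasure data]
    [IsMarkovKernel P] (hp : IsDecoderDensity refX P p) (Q : Kernel 𝒳 (Latent b))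
    [IsMarkovKernel Q] (hQ : EncoderNonsingular refX refZ Q) :
    (DecoderPositive refX p → EncoderPositive refX refZ Q →
        IsErgodicChain refZ (transition Q P)) ∧
      (DecodesTo P (learnedLatent Q data) data →
        (transition Q P).Invariant (learnedLatent Q data) ∧
        (IsErgodicChain refZ (transition Q P) →
          ConvergesToStationary (transition Q P) (learnedLatent Q data)) ∧
        (DecoderPositive refX p → EncoderPositive refX refZ Q →
          ConvergesToStationary (transition Q P) (learnedLatent Q data))) := by
  have hmarkov : IsMarkovKernel (transition Q P) := by unfold transition; infer_instance
  have hprob : IsProbabilityMeasure (learnedLatent Q data) := by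
    unfold learnedLatent; infer_instance
  have hconv : DecodesTo P (learnedLatent Q data) data → IsErgodicChain refZ (transition Q P) →
      ConvergesToStationary (transition Q P) (learnedLatent Q data) := fun hdec herg =>
    herg.convergesToStationary (transition_absolutelyContinuous hp hQ) (transition_invariant hdec)
  exact ⟨isErgodicChain_transition hp, fun hdec => ⟨transition_invariant hdec, hconv hdec,
    fun h1 h2 => hconv hdec (isErgodicChain_transition hp h1 h2)⟩⟩

end Autoencoder

end GenAE

theorem theorem1 {b : ℕ} {𝒳 𝒴 : Type*} [MeasurableSpace 𝒳] [MeasurableSpace 𝒴]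
    -- reference measures `dx` on observations and `dz` on latent codes
    (refX : Measure 𝒳) [SigmaFinite refX]
    (refZ : Measure (GenAE.Latent b)) [SigmaFinite refZ]
    -- the data distribution and the decoder with its conditional density
    (data : Measure 𝒳) [IsProbabilityMeasure data]
    (P : Kernel (GenAE.Latent b) 𝒳) [IsMarkovKernel P]
    (p : GenAE.Latent b → 𝒳 → ℝ≥0∞) (hp : GenAE.IsDecoderDensity refX P p) :
    -- the chain "decode, encode"
    (∀ (Q : Kernel 𝒳 (GenAE.Latent b)) [IsMarkovKernel Q],
      GenAE.EncoderNonsingular refX refZ Q →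
      -- positivity gives ergodicity
      (GenAE.DecoderPositive refX p → GenAE.EncoderPositive refX refZ Q →
        GenAE.IsErgodicChain refZ (GenAE.transition Q P)) ∧
      (GenAE.DecodesTo P (GenAE.learnedLatent Q data) data →
        -- the learned latent distribution is stationary
        (GenAE.transition Q P).Invariant (GenAE.learnedLatent Q data) ∧
        -- ergodicity gives convergence from every initial distribution
        (GenAE.IsErgodicChain refZ (GenAE.transition Q P) →
          GenAE.ConvergesToStationary (GenAE.transition Q P) (GenAE.learnedLatent Q data)) ∧
        -- hence positivity gives convergence from every initial distribution
        (GenAE.DecoderPositive refX p → GenAE.EncoderPositive refX refZ Q →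
          GenAE.ConvergesToStationary (GenAE.transition Q P) (GenAE.learnedLatent Q data)))) ∧
    -- the chain "decode, corrupt, encode"
    (∀ (C : Kernel 𝒳 𝒴) [IsMarkovKernel C] (Q : Kernel 𝒴 (GenAE.Latent b)) [IsMarkovKernel Q],
      GenAE.EncoderNonsingular (C ∘ₘ refX) refZ Q →
      (GenAE.DecoderPositive refX p → GenAE.EncoderPositive (C ∘ₘ refX) refZ Q →
        GenAE.IsErgodicChain refZ (GenAE.denoisingTransition Q C P)) ∧
      (GenAE.DecodesTo P (GenAE.denoisingLearnedLatent Q C data) data →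
        (GenAE.denoisingTransition Q C P).Invariant (GenAE.denoisingLearnedLatent Q C data) ∧
        (GenAE.IsErgodicChain refZ (GenAE.denoisingTransition Q C P) →
          GenAE.ConvergesToStationary (GenAE.denoisingTransition Q C P)
            (GenAE.denoisingLearnedLatent Q C data)) ∧
        (GenAE.DecoderPositive refX p → GenAE.EncoderPositive (C ∘ₘ refX) refZ Q →
          GenAE.ConvergesToStationary (GenAE.denoisingTransition Q C P)
            (GenAE.denoisingLearnedLatent Q C data)))) := by
  exact ⟨fun Q _ hQ => GenAE.generativeAutoencoder_convergence data hp Q hQ, fun C _ Q _ hQ => by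
    -- Corruption is absorbed into the encoder, whose conditions on the image of dx imply those on
    -- dx.
    have h := GenAE.generativeAutoencoder_convergence data hp (Q ∘ₖ C) hQ.comp
    have hT : GenAE.denoisingTransition Q C P = GenAE.transition (Q ∘ₖ C) P :=
      (Kernel.comp_assoc Q C P).symm
    have hL : GenAE.denoisingLearnedLatent Q C data = GenAE.learnedLatent (Q ∘ₖ C) data :=
      Measure.comp_assoc
    rw [hT, hL]
    exact ⟨fun h1 h2 => h.1 h1 h2.comp, fun hdec => ⟨(h.2 hdec).1, (h.2 hdec).2.1,
      fun h1 h2 => (h.2 hdec).2.2 h1 h2.comp⟩⟩⟩
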